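/- Let $n\ge 2$, $0<s<1$, $T>0$, let $\Omega\subset\mathbb R^n$ be a bounded open set (for instance a bounded domain with smooth boundary) and $\Omega_e=\mathbb R^n\setminus\overline\Omega$. Let $$a(x,t,z)=\sum_{k=1}^m a_k(x,t)|z|^{b_k}z,\qquad 0\le a_k\in C(\overline\Omega\times[0,T]),\quad 0<b_1<\dots<b_m .$$ For a nonlinearity $\alpha(x,t,z)$ and exterior data $h$, a weak solution of $$\partial_t u+(-\Delta)^s u+\alpha(x,t,u)=0\ \text{ in }\Omega\times(0,T),\qquad u=h\ \text{ in }(\mathbb R^n\setminus\Omega)\times(0,T),\qquad u=0\ \text{ on }\mathbb R^n\times\{0\}$$ is a function $u\in C([0,T];L^2(\mathbb R^n))\cap L^2(0,T;H^s(\mathbb R^n))$ with $\alpha(\cdot,\cdot,u)\in L^2(\Omega\times(0,T))$, $u(\cdot,t)=h(\cdot,t)$ a.e. in $\mathbb R^n\setminus\Omega$ for every $t\in[0,T]$, $u(\cdot,0)=0$ a.e., and $$\int_\Omega u(x,t)\varphi(x)\,dx+\int_0^t\langle(-\Delta)^su(\tau),\varphi\rangle\,d\tau+\int_0^t\!\int_\Omega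 \alpha(x,\tau,u(x,\tau))\,\varphi(x)\,dx\,d\tau=0$$ for every $t\in[0,T]$ and every $\varphi\in H^s(\mathbb R^n)$ that vanishes a.e. outside $\Omega$, where $$\langle(-\Delta)^sv,\varphi\rangle=\frac{c_{n,s}}2\int_{\mathbb R^n}\int_{\mathbb R^n}\frac{(v(x)-v(y))(\varphi(x)-\varphi(y))}{|x-y|^{n+2s}}\,dx\,dy,\qquad c_{n,s}=\frac{4^s\,s\,\Gamma(\frac n2+s)}{\pi^{n/2}\,\Gamma(1-s)} .$$ Let $g\in C^\infty_c(\Omega_e\times(0,T))$, extended by zero. Let $u_g$ be the weak solution of the linear problem ($\alpha=0$, $h=g$) and, for small $\lambda>0$, let $u_{\lambda,g}$ be the weak solution of the semilinear problem ($\alpha=a$, $h=\lambda g$). Put $v_{\lambda,g}=u_g-u_{\lambda,g}/\lambda$. Then $$\lim_{\lambda\to0^+}\|v_{\lambda,g}\|_{L^\infty(\Omega\times(0,T))}=0 .$$ More precisely, for every weak solution $u_g$ and every $\varepsilon>0$ there is $\lambda_0>0$ such that $\|u_g-u_{\lambda,g}/\lambda\|_{L^\infty(\Omega\times(0,T))}\le\varepsilon$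 for all $0<\lambda<\lambda_0$ and every weak solution $u_{\lambda,g}$ of the semilinear problem with data $\lambda g$. -/

import Mathlib

open MeasureTheory Set Filter Topology

open scoped ENNReal ContDiff

noncomputable section

namespace FracDiffusion

/-- The space `ℝⁿ` with its Euclidean norm. -/
abbrev Rn (n : ℕ) : Type := EuclideanSpace ℝ (Fin n)

/-- The normalizing constant of the fractional Laplacian,
`c_{n,s} = 4^s s Γ(n/2 + s) / (π^{n/2} Γ(1 - s))`, for which the pointwise operator
`c_{n,s} PV ∫ (u(x) - u(y)) / |x - y|^{n + 2s} dy` has Fourier symbol `|ξ|^{2s}`. -/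
def fracConst (n : ℕ) (s : ℝ) : ℝ :=
  (4 : ℝ) ^ s * s * Real.Gamma ((n : ℝ) / 2 + s) /
    (Real.pi ^ ((n : ℝ) / 2) * Real.Gamma (1 - s))

/-- The squared Gagliardo seminorm of `v`,
`∬ |v(x) - v(y)|² / |x - y|^{n + 2s} dx dy`, with values in `[0, ∞]`. -/
def gagliardoSq {n : ℕ} (s : ℝ) (v : Rn n → ℝ) : ℝ≥0∞ :=
  ∫⁻ z : Rn n × Rn n, ENNReal.ofReal ((v z.1 - v z.2) ^ 2 / ‖z.1 - z.2‖ ^ ((n : ℝ) + 2 * s))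

/-- The bilinear form `⟨(-Δ)^s v, φ⟩ =
(c_{n,s} / 2) ∬ (v(x) - v(y)) (φ(x) - φ(y)) / |x - y|^{n + 2s} dx dy`.
The integral converges absolutely as soon as both Gagliardo seminorms are finite. -/
def fracForm {n : ℕ} (s : ℝ) (v φ : Rn n → ℝ) : ℝ :=
  fracConst n s / 2 *
    ∫ z : Rn n × Rn n,
      (v z.1 - v z.2) * (φ z.1 - φ z.2) / ‖z.1 - z.2‖ ^ ((n : ℝ) + 2 * s)

/-- The energy space of the exterior Dirichlet problem:
functions in `H^s(ℝⁿ)`, `0 < s < 1`, that vanish almost everywhere outside `Ω`. -/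
structure IsEnergyFun {n : ℕ} (s : ℝ) (Ω : Set (Rn n)) (φ : Rn n → ℝ) : Prop where
  memLp : MemLp φ 2 volume
  gagliardo_lt_top : gagliardoSq s φ < ⊤
  eq_zero_off : ∀ᵐ x ∂(volume : Measure (Rn n)), x ∉ Ω → φ x = 0

/-- The nonlinearity `a(x, t, z) = ∑ₖ aₖ(x, t) |z|^{bₖ} z`. -/
def powerNonlin {n m : ℕ} (coef : Fin m → Rn n → ℝ → ℝ) (b : Fin m → ℝ)
    (x : Rn n) (t z : ℝ) : ℝ :=
  ∑ k, coef k x t * |z| ^ (b k) * z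

/-- `u` is a weak (energy) solution of
`∂ₜ u + (-Δ)^s u + a(x, t, u) = 0` in `Ω × (0, T)`,
`u = g` in `(ℝⁿ \ Ω) × (0, T)`, `u = 0` on `ℝⁿ × {0}`.
That is, `u ∈ C([0, T]; L²(ℝⁿ)) ∩ L²(0, T; H^s(ℝⁿ))`, `a(x, t, u) ∈ L²(Ω × (0, T))`, the
exterior and initial conditions hold almost everywhere, and the equation holds tested against
every function of the energy space and integrated in time. -/
structure IsWeakSolution {n : ℕ} (s T : ℝ) (Ω : Set (Rn n)) (a : Rn n → ℝ → ℝ → ℝ)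
    (g u : Rn n → ℝ → ℝ) : Prop where
  aestronglyMeasurable : AEStronglyMeasurable (fun z : Rn n × ℝ => u z.1 z.2)
    (volume.restrict (univ ×ˢ Ioo 0 T))
  memLp : ∀ t ∈ Icc 0 T, MemLp (fun x => u x t) 2 volume
  continuous_L2 : ∀ t₀ ∈ Icc 0 T,
    Tendsto (fun t => eLpNorm (fun x => u x t - u x t₀) 2 volume) (𝓝[Icc 0 T] t₀) (𝓝 0)
  energy : ∫⁻ t in Ioo 0 T, gagliardoSq s (fun x => u x t) < ⊤
  nonlin_memLp : MemLp (fun z : Rn n × ℝ => a z.1 z.2 (u z.1 z.2)) 2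
    (volume.restrict (Ω ×ˢ Ioo 0 T))
  exterior : ∀ t ∈ Icc 0 T, ∀ᵐ x ∂(volume : Measure (Rn n)), x ∉ Ω → u x t = g x t
  initial : ∀ᵐ x ∂(volume : Measure (Rn n)), u x 0 = 0
  equation : ∀ φ : Rn n → ℝ, IsEnergyFun s Ω φ → ∀ t ∈ Icc 0 T,
    (∫ x in Ω, u x t * φ x) + (∫ τ in (0 : ℝ)..t, fracForm s (fun x => u x τ) φ)
      + (∫ τ in (0 : ℝ)..t, ∫ x in Ω, a x τ (u x τ) * φ x) = 0

end FracDiffusion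

end

/-! Both estimates behind the theorem are instances of one weak maximum principle,
`nonpos_of_subsolution`, for `∂ₜ v + (-Δ)^s v + F = 0` with `F ≥ 0` where `v > 0`.

With `|g| ≤ M`, the constants `±λM` are barriers for the semilinear solution `u`, because `a(x, t, z)`
has the sign of `z`; hence `|u| ≤ λM` in `Ω × (0, T)` and `|a(x, t, u)| / λ ≤ K(λ)`, where
`K(λ) = ∑ₖ Cₖ (λM)^{bₖ} M` tends to `0` with `λ`. The difference `u_g - u / λ` vanishes outside `Ω`
and at time `0`, and solves the linear equation with source `a(x, t, u) / λ`; comparing it with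
`±K(λ) t` gives `|u_g - u / λ| ≤ K(λ) T`. Both comparisons are made through
`IsWeakSolution.affine_combination_nonpos`.

The maximum principle itself comes from testing against `v⁺`. Weak solutions are only continuous in
time with values in `L²`, so the chain rule for `‖v⁺(t)‖²` is replaced by a time discretization:
the equation between `t - h` and `t` is tested against the fixed function `v(t)⁺`, and the convexity
of `z ↦ (z⁺)² / 2` bounds the increment of `‖v⁺‖² / 2` (`energy_decrement`). After integration over
`t`, what remains is an average over lags `σ ∈ (0, h)` of the pairings of `v(t - σ)` with `v(t)⁺`.
As a function of `σ` such a pairing is an `L²` correlation, continuous because translations act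
continuously on `L²` (`continuous_timeCorrelation`), so division by `h` and `h → 0` give
that `‖v⁺(S)‖² / 2` plus the value at lag zero is at most `0`
(`nonpos_of_discrete_energy_inequality`). The value at lag zero is nonnegative, since
`(v(x) - v(y)) (v⁺(x) - v⁺(y)) ≥ 0` and `F v⁺ ≥ 0`; hence `v⁺ = 0`. -/

noncomputable section

namespace FracDiffusion

/-! ### Time correlations of square-integrable functions -/

theorem measurePreserving_timeShift {X : Type*} [MeasurableSpace X] {μ : Measure X} [SFinite μ]
    (σ : ℝ) :
    MeasurePreserving (fun z : X × ℝ => (z.1, z.2 - σ)) (μ.prod volume) (μ.prod volume) :=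
  (MeasurePreserving.id μ).prod (measurePreserving_sub_right volume σ)

section TimeCorrelation

variable {X : Type*} [TopologicalSpace X] [R1Space X] [MeasurableSpace X] [BorelSpace X]
  {μ : Measure X} [SFinite μ] [IsLocallyFiniteMeasure (μ.prod (volume : Measure ℝ))]
  [(μ.prod (volume : Measure ℝ)).InnerRegularCompactLTTop]

/-- The correlation at time lag `σ` is the `L²` product of `Φ` with a translate of `W`, so it inherits
the strong continuity of translations. -/
theorem continuous_timeCorrelation {W Φ : X × ℝ → ℝ} (hW : MemLp W 2 (μ.prod volume))
    (hΦ : MemLp Φ 2 (μ.prod volume)) :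
    Continuous fun σ : ℝ => ∫ z, W (z.1, z.2 - σ) * Φ z ∂(μ.prod volume) := by
  let g : C(ℝ, C(X × ℝ, X × ℝ)) :=
    (ContinuousMap.mk (fun a : ℝ × (X × ℝ) => (a.2.1, a.2.2 - a.1)) (by fun_prop)).curry
  have hgm : ∀ σ, MeasurePreserving (g σ) (μ.prod volume) (μ.prod volume) :=
    fun σ => measurePreserving_timeShift σ
  have hc : Continuous fun σ : ℝ => Lp.compMeasurePreserving (g σ) (hgm σ) (hW.toLp W) :=
    (continuous_const (y := hW.toLp W)).compMeasurePreservingLp g.continuous hgm (by simp)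
  have hi : Continuous fun σ : ℝ =>
      inner ℝ (hΦ.toLp Φ) (Lp.compMeasurePreserving (g σ) (hgm σ) (hW.toLp W)) :=
    continuous_const.inner hc
  convert hi using 2 with σ
  rw [L2.inner_def]
  refine integral_congr_ae ?_
  filter_upwards [hΦ.coeFn_toLp, Lp.coeFn_compMeasurePreserving (hW.toLp W) (hgm σ),
    (hgm σ).quasiMeasurePreserving.ae_eq_comp hW.coeFn_toLp] with z h1 h2 h3
  rw [h1, h2, h3]
  rfl

/-- The integrand of the time correlation is integrable jointly in the lag, space and time. -/
theorem integrable_timeCorrelation {W Φ : X × ℝ → ℝ} (hW : MemLp W 2 (μ.prod volume))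
    (hΦ : MemLp Φ 2 (μ.prod volume)) (h : ℝ) :
    Integrable (fun y : ℝ × (X × ℝ) => W (y.2.1, y.2.2 - y.1) * Φ y.2)
      ((volume.restrict (Ioc 0 h)).prod (μ.prod volume)) := by
  have hq : Measure.QuasiMeasurePreserving (fun y : ℝ × (X × ℝ) => (y.2.1, y.2.2 - y.1))
      ((volume.restrict (Ioc 0 h)).prod (μ.prod volume)) (μ.prod volume) :=
    QuasiMeasurePreserving.prod_of_right (by fun_prop)
      (ae_of_all _ fun σ => (measurePreserving_timeShift σ).quasiMeasurePreserving)
  have hm : AEStronglyMeasurable (fun y : ℝ × (X × ℝ) => W (y.2.1, y.2.2 - y.1) * Φ y.2)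
      ((volume.restrict (Ioc 0 h)).prod (μ.prod volume)) :=
    (hW.1.comp_quasiMeasurePreserving hq).mul
      (hΦ.1.comp_quasiMeasurePreserving Measure.quasiMeasurePreserving_snd)
  rw [integrable_prod_iff hm]
  constructor
  · refine ae_of_all _ fun σ => ?_
    exact (hW.comp_measurePreserving (measurePreserving_timeShift σ)).integrable_mul hΦ
  -- The marginal in the lag is itself a correlation, hence continuous, hence locally integrable.
  · have := (continuous_timeCorrelation hW.norm hΦ.norm).integrableOn_Ioc (a := 0) (b := h)
      (μ := volume)
    simpa only [norm_mul, IntegrableOn] using this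

/-- Fubini: the lag integral of the time correlation, with the time integral outermost. -/
theorem integral_timeCorrelation {W Φ : X × ℝ → ℝ} (hW : MemLp W 2 (μ.prod volume))
    (hΦ : MemLp Φ 2 (μ.prod volume)) {h : ℝ} (hh : 0 ≤ h) :
    Integrable (fun t : ℝ => ∫ σ in (0 : ℝ)..h, ∫ x, W (x, t - σ) * Φ (x, t) ∂μ) ∧
    ∫ t : ℝ, (∫ σ in (0 : ℝ)..h, ∫ x, W (x, t - σ) * Φ (x, t) ∂μ) =
      ∫ σ in (0 : ℝ)..h, ∫ z, W (z.1, z.2 - σ) * Φ z ∂(μ.prod volume) := by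
  have hG := integrable_timeCorrelation hW hΦ h
  have hmp := (measurePreserving_prodAssoc (volume.restrict (Ioc 0 h)) μ (volume : Measure ℝ))
  have hG' := (hmp.integrable_comp_emb MeasurableEquiv.prodAssoc.measurableEmbedding).2 hG
  have hsec : (fun t : ℝ => ∫ σ in (0 : ℝ)..h, ∫ x, W (x, t - σ) * Φ (x, t) ∂μ) =ᵐ[volume]
      fun t => ∫ y : ℝ × X, W (y.2, t - y.1) * Φ (y.2, t) ∂((volume.restrict (Ioc 0 h)).prod μ) := by
    filter_upwards [hG'.prod_left_ae] with t ht
    rw [intervalIntegral.integral_of_le hh]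
    exact (integral_prod _ ht).symm
  have hint := hG'.integral_prod_right
  refine ⟨hint.congr hsec.symm, ?_⟩
  rw [integral_congr_ae hsec, intervalIntegral.integral_of_le hh, ← integral_prod _ hG,
    ← hmp.integral_comp MeasurableEquiv.prodAssoc.measurableEmbedding]
  exact (integral_prod_symm _ hG').symm

end TimeCorrelation

/-- Dividing by `h` and letting `h → 0⁺`: both integrals are over intervals of length `h`, shrinking
to `S` and to `0`. -/
theorem le_neg_of_integral_le {q J : ℝ → ℝ} (hq : Continuous q) (hJ : Continuous J) {S : ℝ}
    (hS : 0 < S)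
    (hle : ∀ h, 0 < h → h < S → (∫ t in (S - h)..S, q t) + (∫ σ in (0 : ℝ)..h, J σ) ≤ 0) :
    q S + J 0 ≤ 0 := by
  have h1 : HasDerivAt (fun h : ℝ => ∫ t in (0 : ℝ)..h, (q (S - t) + J t)) (q (S - 0) + J 0) 0 :=
    intervalIntegral.integral_hasDerivAt_right
      ((by fun_prop : Continuous fun t => q (S - t) + J t).intervalIntegrable _ _)
      ((by fun_prop : Continuous fun t => q (S - t) + J t).stronglyMeasurableAtFilter _ _)
      (by fun_prop)
  have h2 := h1.tendsto_slope_zero_right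
  rw [sub_zero] at h2
  refine le_of_tendsto h2 ?_
  filter_upwards [Ioo_mem_nhdsGT hS] with h hh
  have := hle h hh.1 hh.2
  rw [zero_add, intervalIntegral.integral_same, sub_zero, smul_eq_mul,
    intervalIntegral.integral_add
      ((by fun_prop : Continuous fun t => q (S - t)).intervalIntegrable _ _)
      (hJ.intervalIntegrable _ _), intervalIntegral.integral_comp_sub_left (fun t => q t) S, sub_zero]
  exact mul_nonpos_of_nonneg_of_nonpos (inv_nonneg.2 hh.1.le) this

/-- Telescoping: `∫₀ˢ (q(t) - q(t - h)) dt` is an integral near `S` when `q` vanishes in the past. -/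
theorem integral_sub_shift {q : ℝ → ℝ} (hq : Continuous q) (hq0 : ∀ t ≤ 0, q t = 0) {S h : ℝ}
    (hh : 0 ≤ h) :
    ∫ t in (0 : ℝ)..S, (q t - q (t - h)) = ∫ t in (S - h)..S, q t := by
  have hi : ∀ a b, IntervalIntegrable q volume a b := fun a b => hq.intervalIntegrable _ _
  have h0 : ∫ t in (0 - h)..0, q t = 0 := by
    rw [intervalIntegral.integral_congr (g := fun _ => (0 : ℝ))]
    · simp
    · intro t ht
      rw [uIcc_of_le (by linarith)] at ht
      exact hq0 t ht.2
  rw [intervalIntegral.integral_sub (hi _ _)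
    ((by fun_prop : Continuous fun t => q (t - h)).intervalIntegrable _ _),
    intervalIntegral.integral_comp_sub_right q h]
  have e1 := intervalIntegral.integral_add_adjacent_intervals (hi (0 - h) 0) (hi 0 S)
  have e2 := intervalIntegral.integral_add_adjacent_intervals (hi (0 - h) (S - h)) (hi (S - h) S)
  linarith

/-- Limit of vanishing time step in the discrete energy inequality: `q` is half the squared norm of
the positive part, and the two correlations stand for the fractional and the zeroth-order terms.
The step `h` may exceed `t`, since `q` and the `Wᵢ` in use vanish at negative times. -/
theorem nonpos_of_discrete_energy_inequality
    {X : Type*} [TopologicalSpace X] [R1Space X] [MeasurableSpace X] [BorelSpace X]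
    {μ : Measure X} [SFinite μ]
    [IsLocallyFiniteMeasure (μ.prod (volume : Measure ℝ))]
    [(μ.prod (volume : Measure ℝ)).InnerRegularCompactLTTop]
    {Y : Type*} [TopologicalSpace Y] [R1Space Y] [MeasurableSpace Y] [BorelSpace Y]
    {ν : Measure Y} [SFinite ν]
    [IsLocallyFiniteMeasure (ν.prod (volume : Measure ℝ))]
    [(ν.prod (volume : Measure ℝ)).InnerRegularCompactLTTop]
    {W₁ Φ₁ : X × ℝ → ℝ} (hW₁ : MemLp W₁ 2 (μ.prod volume)) (hΦ₁ : MemLp Φ₁ 2 (μ.prod volume))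
    {W₂ Φ₂ : Y × ℝ → ℝ} (hW₂ : MemLp W₂ 2 (ν.prod volume)) (hΦ₂ : MemLp Φ₂ 2 (ν.prod volume))
    {q : ℝ → ℝ} (hq : Continuous q) (hq0 : ∀ t ≤ 0, q t = 0) {S : ℝ} (hS : 0 < S)
    (hΦ₁S : ∀ x, ∀ t, t ∉ Ioo 0 S → Φ₁ (x, t) = 0) (hΦ₂S : ∀ x, ∀ t, t ∉ Ioo 0 S → Φ₂ (x, t) = 0)
    (hle : ∀ h, 0 < h → ∀ᵐ t : ℝ, t ∈ Ioo 0 S → q t - q (t - h) +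
      ((∫ σ in (0 : ℝ)..h, ∫ x, W₁ (x, t - σ) * Φ₁ (x, t) ∂μ) +
        ∫ σ in (0 : ℝ)..h, ∫ x, W₂ (x, t - σ) * Φ₂ (x, t) ∂ν) ≤ 0)
    (hpos₁ : 0 ≤ ∫ z, W₁ z * Φ₁ z ∂(μ.prod volume))
    (hpos₂ : 0 ≤ ∫ z, W₂ z * Φ₂ z ∂(ν.prod volume)) : q S ≤ 0 := by
  have hJ₁ := continuous_timeCorrelation hW₁ hΦ₁
  have hJ₂ := continuous_timeCorrelation hW₂ hΦ₂
  have key := le_neg_of_integral_le hq (hJ₁.add hJ₂) hS ?_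
  · simp only [Pi.add_apply, sub_zero] at key
    linarith
  intro h hh _
  simp only [Pi.add_apply]
  obtain ⟨hi₁, he₁⟩ := integral_timeCorrelation hW₁ hΦ₁ hh.le
  obtain ⟨hi₂, he₂⟩ := integral_timeCorrelation hW₂ hΦ₂ hh.le
  rw [intervalIntegral.integral_add (hJ₁.intervalIntegrable _ _) (hJ₂.intervalIntegrable _ _),
    ← he₁, ← he₂, ← integral_add hi₁ hi₂, ← integral_sub_shift hq hq0 hh.le]
  rw [← setIntegral_eq_integral_of_forall_compl_eq_zero (s := Ioo 0 S),
    intervalIntegral.integral_of_le hS.le, integral_Ioc_eq_integral_Ioo, ← integral_add]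
  · refine integral_nonpos_of_ae ?_
    filter_upwards [ae_restrict_of_ae (hle h hh), ae_restrict_mem measurableSet_Ioo] with t h1 h2
    exact h1 h2
  · exact (by fun_prop : Continuous fun t => q t - q (t - h)).integrableOn_Icc.mono_set
      Ioo_subset_Icc_self
  · exact (hi₁.add hi₂).integrableOn
  · intro t ht
    simp [hΦ₁S _ t ht, hΦ₂S _ t ht]

/-! ### The fractional energy and positive parts -/

/-- The Gagliardo difference quotient `(w(x) - w(y)) / |x - y|^{(n + 2s)/2}`, which turns the
fractional energy into an `L²` product over pairs of points. -/
def diffQuot {n : ℕ} (s : ℝ) (w : Rn n → ℝ) (z : Rn n × Rn n) : ℝ :=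
  (w z.1 - w z.2) / √(‖z.1 - z.2‖ ^ ((n : ℝ) + 2 * s))

variable {n : ℕ} {s T : ℝ} {Ω : Set (Rn n)}

theorem diffQuot_mul (w φ : Rn n → ℝ) (z : Rn n × Rn n) :
    diffQuot s w z * diffQuot s φ z =
      (w z.1 - w z.2) * (φ z.1 - φ z.2) / ‖z.1 - z.2‖ ^ ((n : ℝ) + 2 * s) := by
  rw [diffQuot, diffQuot, div_mul_div_comm, Real.mul_self_sqrt (by positivity)]

theorem enorm_sq_eq_ofReal (a : ℝ) : ‖a‖ₑ ^ (2 : ℝ) = ENNReal.ofReal (a ^ 2) := by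
  rw [Real.enorm_eq_ofReal_abs, ENNReal.ofReal_rpow_of_nonneg (abs_nonneg a) (by norm_num)]
  simp

theorem memLp_two_iff_lintegral_sq {α : Type*} [MeasurableSpace α] {μ : Measure α} {f : α → ℝ}
    (hf : AEStronglyMeasurable f μ) :
    MemLp f 2 μ ↔ ∫⁻ x, ENNReal.ofReal (f x ^ 2) ∂μ < ⊤ := by
  have h : eLpNorm f 2 μ < ⊤ ↔ ∫⁻ x, ENNReal.ofReal (f x ^ 2) ∂μ < ⊤ := by
    rw [eLpNorm_lt_top_iff_lintegral_rpow_enorm_lt_top (by norm_num) (by norm_num)]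
    simp only [ENNReal.toReal_ofNat, enorm_sq_eq_ofReal]
  exact ⟨fun H => h.1 H.2, fun H => ⟨hf, h.2 H⟩⟩

theorem gagliardoSq_eq_lintegral_diffQuot (w : Rn n → ℝ) :
    gagliardoSq s w = ∫⁻ z, ENNReal.ofReal (diffQuot s w z ^ 2) := by
  simp only [gagliardoSq, pow_two, diffQuot_mul]

theorem fracForm_eq_integral_diffQuot (w φ : Rn n → ℝ) :
    fracForm s w φ = ∫ z, (fracConst n s / 2 * diffQuot s w z) * diffQuot s φ z := by
  simp only [fracForm, mul_assoc, diffQuot_mul, integral_const_mul]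

theorem measurable_diffQuot_denom :
    Measurable fun z : Rn n × Rn n => √(‖z.1 - z.2‖ ^ ((n : ℝ) + 2 * s)) := by
  fun_prop

theorem memLp_diffQuot {w : Rn n → ℝ} (hw : AEStronglyMeasurable w volume)
    (hE : gagliardoSq s w < ⊤) : MemLp (diffQuot s w) 2 volume := by
  refine (memLp_two_iff_lintegral_sq ?_).2 (gagliardoSq_eq_lintegral_diffQuot w ▸ hE)
  refine AEMeasurable.aestronglyMeasurable (AEMeasurable.div (AEMeasurable.sub ?_ ?_)
    measurable_diffQuot_denom.aemeasurable)
  · exact hw.aemeasurable.comp_quasiMeasurePreserving Measure.quasiMeasurePreserving_fst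
  · exact hw.aemeasurable.comp_quasiMeasurePreserving Measure.quasiMeasurePreserving_snd

theorem gagliardoSq_posPart_le (w : Rn n → ℝ) :
    gagliardoSq s (fun x => max (w x) 0) ≤ gagliardoSq s w := by
  refine lintegral_mono fun z => ENNReal.ofReal_le_ofReal ?_
  refine div_le_div_of_nonneg_right (sq_le_sq.2 ?_) (by positivity)
  exact abs_max_sub_max_le_abs _ _ _

/-- The truncation `w ↦ w⁺` is monotone, so the increments of `w` and `w⁺` have the same sign; this
makes the fractional term nonnegative when the equation is tested against `w⁺`. -/
theorem diffQuot_mul_posPart_nonneg (w : Rn n → ℝ) (z : Rn n × Rn n) :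
    0 ≤ diffQuot s w z * diffQuot s (fun x => max (w x) 0) z := by
  rw [diffQuot_mul]
  refine div_nonneg ?_ (by positivity)
  rcases le_total (w z.1) (w z.2) with h | h
  · exact mul_nonneg_of_nonpos_of_nonpos (sub_nonpos.2 h) (sub_nonpos.2 (max_le_max h le_rfl))
  · exact mul_nonneg (sub_nonneg.2 h) (sub_nonneg.2 (max_le_max h le_rfl))

theorem fracConst_nonneg (hs0 : 0 < s) (hs1 : s < 1) : 0 ≤ fracConst n s := by
  have h1 : 0 < Real.Gamma ((n : ℝ) / 2 + s) := Real.Gamma_pos_of_pos (by positivity)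
  have h2 : 0 < Real.Gamma (1 - s) := Real.Gamma_pos_of_pos (by linarith)
  unfold fracConst
  positivity

theorem memLp_diffQuot_time {v : Rn n → ℝ → ℝ}
    (hv : AEStronglyMeasurable (fun z : Rn n × ℝ => v z.1 z.2) (volume.restrict (univ ×ˢ Ioo 0 T)))
    (hE : ∫⁻ t in Ioo 0 T, gagliardoSq s (fun x => v x t) < ⊤) :
    MemLp (fun y : (Rn n × Rn n) × ℝ => diffQuot s (fun x => v x y.2) y.1) 2
      ((volume : Measure (Rn n × Rn n)).prod (volume.restrict (Ioo 0 T))) := by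
  rw [Measure.volume_eq_prod, ← Measure.prod_restrict, Measure.restrict_univ] at hv
  have hm : AEMeasurable (fun y : (Rn n × Rn n) × ℝ => diffQuot s (fun x => v x y.2) y.1)
      ((volume : Measure (Rn n × Rn n)).prod (volume.restrict (Ioo 0 T))) := by
    refine AEMeasurable.div (AEMeasurable.sub ?_ ?_)
      (measurable_diffQuot_denom.comp measurable_fst).aemeasurable
    · exact hv.aemeasurable.comp_quasiMeasurePreserving
        (QuasiMeasurePreserving.prodMap Measure.quasiMeasurePreserving_fst (.id _))
    · exact hv.aemeasurable.comp_quasiMeasurePreserving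
        (QuasiMeasurePreserving.prodMap Measure.quasiMeasurePreserving_snd (.id _))
  rw [memLp_two_iff_lintegral_sq hm.aestronglyMeasurable, lintegral_prod_symm]
  · simpa only [gagliardoSq_eq_lintegral_diffQuot] using hE
  · exact (hm.pow_const 2).ennreal_ofReal

theorem memLp_indicator_time {X : Type*} [MeasurableSpace X] {μ : Measure X} [SFinite μ]
    {f : X × ℝ → ℝ} {A : Set X} (hA : MeasurableSet A) {S : ℝ}
    (hf : MemLp f 2 ((μ.restrict A).prod (volume.restrict (Ioo 0 S)))) :
    MemLp ((A ×ˢ Ioo 0 S).indicator f) 2 (μ.prod volume) := by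
  rwa [memLp_indicator_iff_restrict (hA.prod measurableSet_Ioo), ← Measure.prod_restrict]

/-- Pairing an `L²` function of space and time with an `L²` function of space. -/
theorem integrableOn_pairing {X : Type*} [MeasurableSpace X] {μ : Measure X} [SFinite μ]
    {f : X × ℝ → ℝ} {ψ : X → ℝ} {S : ℝ} (hf : MemLp f 2 (μ.prod (volume.restrict (Ioo 0 S))))
    (hψ : MemLp ψ 2 μ) : IntegrableOn (fun τ => ∫ x, f (x, τ) * ψ x ∂μ) (Ioo 0 S) :=
  (hf.integrable_mul (hψ.comp_fst (volume.restrict (Ioo 0 S)))).integral_prod_right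

theorem intervalIntegrable_of_integrableOn_Ioo {f : ℝ → ℝ} {S a b : ℝ}
    (hf : IntegrableOn f (Ioo 0 S)) (ha : a ∈ Icc 0 S) (hb : b ∈ Icc 0 S) :
    IntervalIntegrable f volume a b := by
  have h : IntervalIntegrable f volume 0 S :=
    (intervalIntegrable_iff_integrableOn_Ioo_of_le (ha.1.trans ha.2)).2 hf
  refine h.mono_set ?_
  rw [uIcc_of_le (ha.1.trans ha.2)]
  exact uIcc_subset_Icc ha hb

/-- Over the last `h` units of time before `t`, extension by zero outside `(0, T)` amounts to stopping
the integral at time `0`. -/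
theorem integral_lag_indicator (f : ℝ → ℝ) {h t : ℝ} (hh : 0 ≤ h) (ht : t ∈ Ioo 0 T) :
    ∫ σ in (0 : ℝ)..h, (Ioo 0 T).indicator f (t - σ) = ∫ τ in (max 0 (t - h))..t, f τ := by
  rw [intervalIntegral.integral_comp_sub_left (fun τ => (Ioo 0 T).indicator f τ) t, sub_zero,
    intervalIntegral.integral_of_le (by linarith),
    intervalIntegral.integral_of_le (max_le ht.1.le (by linarith)),
    setIntegral_indicator measurableSet_Ioo]
  congr 2
  ext τ
  simp only [mem_inter_iff, mem_Ioc, mem_Ioo, max_lt_iff]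
  constructor
  · rintro ⟨⟨h1, h2⟩, h3, h4⟩
    exact ⟨⟨h3, h1⟩, h2⟩
  · rintro ⟨⟨h1, h2⟩, h3⟩
    exact ⟨⟨h2, h3⟩, h1, h3.trans_lt ht.2⟩

/-- Half the squared `L²(Ω)` norm of the positive part of `v(·, t)`. -/
def posEnergy (Ω : Set (Rn n)) (v : Rn n → ℝ → ℝ) (t : ℝ) : ℝ :=
  1 / 2 * ∫ x in Ω, (max (v x t) 0) ^ 2

theorem posEnergy_nonneg (v : Rn n → ℝ → ℝ) (t : ℝ) : 0 ≤ posEnergy Ω v t :=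
  mul_nonneg (by norm_num) (integral_nonneg fun _ => sq_nonneg _)

theorem continuousOn_posEnergy {v : Rn n → ℝ → ℝ}
    (hL2 : ∀ t ∈ Icc 0 T, MemLp (fun x => v x t) 2 (volume.restrict Ω))
    (hcont : ∀ t₀ ∈ Icc 0 T, Tendsto (fun t => eLpNorm (fun x => v x t - v x t₀) 2
      (volume.restrict Ω)) (𝓝[Icc 0 T] t₀) (𝓝 0)) :
    ContinuousOn (posEnergy Ω v) (Icc 0 T) := by
  rw [continuousOn_iff_continuous_domRestrict]
  let f : Icc 0 T → Lp ℝ 2 (volume.restrict Ω) := fun t => (hL2 t t.2).toLp _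
  have hf : Continuous f := by
    rw [continuous_iff_continuousAt]
    intro t₀
    rw [ContinuousAt, tendsto_iff_edist_tendsto_0]
    have := (tendsto_nhdsWithin_iff_subtype t₀.2 _ _).1 (hcont t₀ t₀.2)
    refine this.congr fun t => ?_
    exact (Lp.edist_toLp_toLp _ _ (hL2 t t.2) (hL2 t₀ t₀.2)).symm
  have hP : Continuous fun t => 1 / 2 * ‖Lp.posPart (f t)‖ ^ 2 := by
    have := Lp.continuous_posPart.comp hf
    exact continuous_const.mul (this.norm.pow 2)
  convert hP using 2 with t
  rw [domRestrict_apply, posEnergy, ← real_inner_self_eq_norm_sq, L2.inner_def]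
  congr 1
  refine integral_congr_ae ?_
  filter_upwards [Lp.coeFn_posPart (f t), (hL2 t t.2).coeFn_toLp] with x h1 h2
  rw [h1, h2, real_inner_self_eq_norm_sq, Real.norm_eq_abs, sq_abs]

/-- Tonelli, relating the space-time norm of `v⁺` to its energies at fixed times. -/
theorem lintegral_posPart_sq {v : Rn n → ℝ → ℝ} {S : ℝ} (hST : S ≤ T)
    (hv : AEStronglyMeasurable (fun z : Rn n × ℝ => v z.1 z.2)
      ((volume.restrict Ω).prod (volume.restrict (Ioo 0 S))))
    (hL2 : ∀ t ∈ Icc 0 T, MemLp (fun x => v x t) 2 (volume.restrict Ω)) :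
    ∫⁻ z, ENNReal.ofReal ((max (v z.1 z.2) 0) ^ 2)
      ∂((volume.restrict Ω).prod (volume.restrict (Ioo 0 S))) =
    ∫⁻ t in Ioo 0 S, ENNReal.ofReal (2 * posEnergy Ω v t) := by
  rw [lintegral_prod_symm]
  · refine setLIntegral_congr_fun measurableSet_Ioo fun t ht => ?_
    rw [posEnergy, ← mul_assoc, mul_one_div_cancel two_ne_zero, one_mul,
      ofReal_integral_eq_lintegral_ofReal]
    · exact (hL2 t ⟨ht.1.le, ht.2.le.trans hST⟩).pos_part.integrable_sq
    · exact ae_of_all _ fun _ => sq_nonneg _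
  · exact ((hv.aemeasurable.max aemeasurable_const).pow_const 2).ennreal_ofReal

/-- Convexity of `z ↦ (z⁺)² / 2`, whose derivative is `z⁺`. -/
theorem half_sq_posPart_sub_le (a b : ℝ) :
    1 / 2 * (max a 0) ^ 2 - 1 / 2 * (max b 0) ^ 2 ≤ (a - b) * max a 0 := by
  have hb : b ≤ max b 0 := le_max_left _ _
  have ha0 : 0 ≤ max a 0 := le_max_right _ _
  have ha : a * max a 0 = max a 0 ^ 2 := by
    rcases le_total a 0 with h | h
    · simp [h]
    · simp [h, sq]
  nlinarith [sq_nonneg (max a 0 - max b 0), mul_le_mul_of_nonneg_right hb ha0]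

/-! ### The weak maximum principle -/

theorem isEnergyFun_posPart (hΩ : MeasurableSet Ω) {w : Rn n → ℝ}
    (hL2 : MemLp w 2 (volume.restrict Ω)) (hext : ∀ᵐ x, x ∉ Ω → w x ≤ 0)
    (hE : gagliardoSq s w < ⊤) : IsEnergyFun s Ω fun x => max (w x) 0 where
  memLp := by
    refine ((memLp_indicator_iff_restrict hΩ).2 hL2.pos_part).ae_eq ?_
    filter_upwards [hext] with x hx
    by_cases h : x ∈ Ω
    · simp [h]
    · simp [h, hx h]
  gagliardo_lt_top := (gagliardoSq_posPart_le w).trans_lt hE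
  eq_zero_off := hext.mono fun x hx h => max_eq_right (hx h)

/-- The equation between times `r` and `t`, tested against the fixed function `v(·, t)⁺`. By convexity
the difference of the positive energies is at most the pairing of `v(t) - v(r)` with `v(t)⁺`, so no
time derivative of `v` is needed. -/
theorem energy_decrement (hΩ : MeasurableSet Ω) {v F : Rn n → ℝ → ℝ} {w₀ : Rn n → ℝ}
    (hw₀ : MemLp w₀ 2 (volume.restrict Ω))
    (hv : AEStronglyMeasurable (fun z : Rn n × ℝ => v z.1 z.2) (volume.restrict (univ ×ˢ Ioo 0 T)))
    (hL2 : ∀ t ∈ Icc 0 T, MemLp (fun x => v x t) 2 (volume.restrict Ω))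
    (hE : ∫⁻ t in Ioo 0 T, gagliardoSq s (fun x => v x t) < ⊤)
    (hF : MemLp (fun z : Rn n × ℝ => F z.1 z.2) 2
      ((volume.restrict Ω).prod (volume.restrict (Ioo 0 T))))
    (hext : ∀ t ∈ Icc 0 T, ∀ᵐ x, x ∉ Ω → v x t ≤ 0)
    (heq : ∀ φ : Rn n → ℝ, IsEnergyFun s Ω φ → ∀ t ∈ Icc 0 T,
      (∫ x in Ω, (v x t - w₀ x) * φ x) + (∫ τ in (0 : ℝ)..t, fracForm s (fun x => v x τ) φ)
        + (∫ τ in (0 : ℝ)..t, ∫ x in Ω, F x τ * φ x) = 0)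
    {t r : ℝ} (ht : t ∈ Icc 0 T) (hr : r ∈ Icc 0 T) (hEt : gagliardoSq s (fun x => v x t) < ⊤) :
    posEnergy Ω v t - posEnergy Ω v r +
      ((∫ τ in r..t, fracForm s (fun x => v x τ) fun x => max (v x t) 0) +
        ∫ τ in r..t, ∫ x in Ω, F x τ * max (v x t) 0) ≤ 0 := by
  set φ : Rn n → ℝ := fun x => max (v x t) 0 with hφ
  have hφE : IsEnergyFun s Ω φ := isEnergyFun_posPart hΩ (hL2 t ht) (hext t ht) hEt
  have hφΩ : MemLp φ 2 (volume.restrict Ω) := hφE.memLp.restrict Ω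
  have h0 : (0 : ℝ) ∈ Icc 0 T := ⟨le_rfl, ht.1.trans ht.2⟩
  have hi₁ : IntegrableOn (fun τ => fracForm s (fun x => v x τ) φ) (Ioo 0 T) := by
    simp only [fracForm_eq_integral_diffQuot]
    exact integrableOn_pairing ((memLp_diffQuot_time hv hE).const_mul _)
      (memLp_diffQuot hφE.memLp.1 hφE.gagliardo_lt_top)
  have hi₂ : IntegrableOn (fun τ => ∫ x in Ω, F x τ * φ x) (Ioo 0 T) :=
    integrableOn_pairing hF hφΩ
  have a₁ := intervalIntegral.integral_interval_sub_left
    (intervalIntegrable_of_integrableOn_Ioo hi₁ h0 ht)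
    (intervalIntegrable_of_integrableOn_Ioo hi₁ h0 hr)
  have a₂ := intervalIntegral.integral_interval_sub_left
    (intervalIntegrable_of_integrableOn_Ioo hi₂ h0 ht)
    (intervalIntegrable_of_integrableOn_Ioo hi₂ h0 hr)
  have e₁ := heq φ hφE t ht
  have e₂ := heq φ hφE r hr
  have b₁ : Integrable (fun x => (v x t - w₀ x) * φ x) (volume.restrict Ω) :=
    ((hL2 t ht).sub hw₀).integrable_mul hφΩ
  have b₂ : Integrable (fun x => (v x r - w₀ x) * φ x) (volume.restrict Ω) :=
    ((hL2 r hr).sub hw₀).integrable_mul hφΩ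
  have c : posEnergy Ω v t - posEnergy Ω v r ≤
      (∫ x in Ω, (v x t - w₀ x) * φ x) - ∫ x in Ω, (v x r - w₀ x) * φ x := by
    have d₁ := ((hL2 t ht).pos_part.integrable_sq).const_mul (1 / 2)
    have d₂ := ((hL2 r hr).pos_part.integrable_sq).const_mul (1 / 2)
    rw [posEnergy, posEnergy, ← integral_const_mul, ← integral_const_mul, ← integral_sub d₁ d₂,
      ← integral_sub b₁ b₂]
    refine integral_mono (d₁.sub d₂) (b₁.sub b₂) fun x => ?_
    refine (half_sq_posPart_sub_le (v x t) (v x r)).trans_eq ?_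
    simp only [hφ]
    ring
  linarith

/-- **Weak maximum principle.** Here `v` solves `∂ₜ v + (-Δ)^s v + F = 0` weakly in `Ω × (0, T)`, with
`v ≤ 0` outside `Ω` and at time `0`, and `F ≥ 0` wherever `v > 0`. The equation involves `v(t) - w₀`
for an arbitrary reference `w₀ ∈ L²(Ω)`, which cancels in differences between two times. -/
theorem nonpos_of_subsolution (hs0 : 0 < s) (hs1 : s < 1) (hΩ : MeasurableSet Ω)
    {v F : Rn n → ℝ → ℝ} {w₀ : Rn n → ℝ}
    (hw₀ : MemLp w₀ 2 (volume.restrict Ω))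
    (hv : AEStronglyMeasurable (fun z : Rn n × ℝ => v z.1 z.2) (volume.restrict (univ ×ˢ Ioo 0 T)))
    (hL2 : ∀ t ∈ Icc 0 T, MemLp (fun x => v x t) 2 (volume.restrict Ω))
    (hcont : ∀ t₀ ∈ Icc 0 T, Tendsto (fun t => eLpNorm (fun x => v x t - v x t₀) 2
      (volume.restrict Ω)) (𝓝[Icc 0 T] t₀) (𝓝 0))
    (hE : ∫⁻ t in Ioo 0 T, gagliardoSq s (fun x => v x t) < ⊤)
    (hF : MemLp (fun z : Rn n × ℝ => F z.1 z.2) 2 (volume.restrict (Ω ×ˢ Ioo 0 T)))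
    (hext : ∀ t ∈ Icc 0 T, ∀ᵐ x, x ∉ Ω → v x t ≤ 0)
    (hinit : ∀ᵐ x ∂(volume.restrict Ω), v x 0 ≤ 0)
    (heq : ∀ φ : Rn n → ℝ, IsEnergyFun s Ω φ → ∀ t ∈ Icc 0 T,
      (∫ x in Ω, (v x t - w₀ x) * φ x) + (∫ τ in (0 : ℝ)..t, fracForm s (fun x => v x τ) φ)
        + (∫ τ in (0 : ℝ)..t, ∫ x in Ω, F x τ * φ x) = 0)
    (hsign : ∀ᵐ z : Rn n × ℝ ∂(volume.restrict (Ω ×ˢ Ioo 0 T)), 0 < v z.1 z.2 → 0 ≤ F z.1 z.2) :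
    ∀ᵐ z : Rn n × ℝ ∂(volume.restrict (Ω ×ˢ Ioo 0 T)), v z.1 z.2 ≤ 0 := by
  have hvΩ : AEStronglyMeasurable (fun z : Rn n × ℝ => v z.1 z.2)
      (volume.restrict (Ω ×ˢ Ioo 0 T)) :=
    hv.mono_measure (Measure.restrict_mono (prod_mono_left (subset_univ _)) le_rfl)
  have hsign' := (ae_restrict_iff' (hΩ.prod measurableSet_Ioo)).1 hsign
  rw [Measure.volume_eq_prod] at hsign'
  rw [Measure.volume_eq_prod, ← Measure.prod_restrict] at hF hvΩ ⊢
  have hPc := continuousOn_posEnergy hL2 hcont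
  have hP0 : posEnergy Ω v 0 = 0 := by
    rw [posEnergy, integral_eq_zero_of_ae, mul_zero]
    filter_upwards [hinit] with x hx
    simp [hx]
  have hgood : ∀ᵐ t, t ∈ Ioo 0 T → gagliardoSq s (fun x => v x t) < ⊤ := by
    rw [← ae_restrict_iff' measurableSet_Ioo]
    filter_upwards [(memLp_diffQuot_time hv hE).integrable_sq.prod_left_ae] with t ht
    rw [gagliardoSq_eq_lintegral_diffQuot, ← ofReal_integral_eq_lintegral_ofReal ht
      (ae_of_all _ fun _ => sq_nonneg _)]
    exact ENNReal.ofReal_lt_top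
  have hP : ∀ S ∈ Ioo 0 T, posEnergy Ω v S ≤ 0 := by
    intro S hS
    have hT : (0 : ℝ) ≤ T := hS.1.le.trans hS.2.le
    -- Constant extension of the energy; to the left of `0` its value is the initial energy, zero.
    set q : ℝ → ℝ := fun t => posEnergy Ω v (projIcc 0 T hT t) with hq
    have hqc : Continuous q :=
      (continuousOn_iff_continuous_domRestrict.1 hPc).comp continuous_projIcc
    have hqP : ∀ t ∈ Icc 0 T, q t = posEnergy Ω v t := fun t ht => by
      simp only [hq, projIcc_of_mem hT ht]
    have hq0 : ∀ t ≤ 0, q t = 0 := fun t ht => by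
      simp only [hq, projIcc_of_le_left hT ht, hP0]
    have hqmax : ∀ t ≤ T, q t = posEnergy Ω v (max 0 t) := fun t ht => by
      simp only [hq, projIcc, min_eq_right ht]
    have hsub : Ioo 0 S ⊆ Ioo 0 T := Ioo_subset_Ioo_right hS.2.le
    have hvS : AEStronglyMeasurable (fun z : Rn n × ℝ => v z.1 z.2)
        (volume.restrict (univ ×ˢ Ioo 0 S)) :=
      hv.mono_measure (Measure.restrict_mono (prod_mono_right hsub) le_rfl)
    have hvΩS : AEStronglyMeasurable (fun z : Rn n × ℝ => v z.1 z.2)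
        ((volume.restrict Ω).prod (volume.restrict (Ioo 0 S))) := by
      rw [Measure.prod_restrict] at hvΩ ⊢
      exact hvΩ.mono_measure (Measure.restrict_mono (prod_mono_right hsub) le_rfl)
    -- Extension by zero in time: up to `T` for the solution, only up to `S` for the test function, so
    -- that the outer time integral runs over `(0, S)`.
    have mW₁ := memLp_indicator_time (μ := (volume : Measure (Rn n × Rn n))) MeasurableSet.univ
      (by simpa only [Measure.restrict_univ] using
        (memLp_diffQuot_time hv hE).const_mul (fracConst n s / 2))
    have hΦ₁ := memLp_diffQuot_time (s := s) (v := fun x t => max (v x t) 0)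
      (hvS.aemeasurable.max aemeasurable_const).aestronglyMeasurable
      (((lintegral_mono fun t => gagliardoSq_posPart_le _).trans
        (lintegral_mono_set hsub)).trans_lt hE)
    have mΦ₁ := memLp_indicator_time (μ := (volume : Measure (Rn n × Rn n))) MeasurableSet.univ
      (by simpa only [Measure.restrict_univ] using hΦ₁)
    have mW₂ := memLp_indicator_time (μ := (volume : Measure (Rn n))) hΩ hF
    have mΦ₂ := memLp_indicator_time (μ := (volume : Measure (Rn n))) hΩ
      (f := fun z => max (v z.1 z.2) 0) (S := S) (by
        rw [memLp_two_iff_lintegral_sq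
          (hvΩS.aemeasurable.max aemeasurable_const).aestronglyMeasurable,
          lintegral_posPart_sq hS.2.le hvΩS hL2]
        have hi : IntegrableOn (fun t => 2 * posEnergy Ω v t) (Ioo 0 S) :=
          ((hPc.const_mul 2).integrableOn_Icc).mono_set
            (hsub.trans Ioo_subset_Icc_self)
        rw [← ofReal_integral_eq_lintegral_ofReal hi
          (ae_of_all _ fun t => mul_nonneg two_pos.le (posEnergy_nonneg v t))]
        exact ENNReal.ofReal_lt_top)
    rw [← hqP S ⟨hS.1.le, hS.2.le⟩]
    refine nonpos_of_discrete_energy_inequality mW₁ mΦ₁ mW₂ mΦ₂ hqc hq0 hS.1 ?_ ?_ ?_ ?_ ?_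
    · intro x t ht
      exact indicator_of_notMem (fun h => ht h.2) _
    · intro x t ht
      exact indicator_of_notMem (fun h => ht h.2) _
    · intro h hh
      filter_upwards [hgood] with t hgt htS
      have htT := hsub htS
      have key := energy_decrement hΩ hw₀ hv hL2 hE hF hext heq (Ioo_subset_Icc_self htT)
        (r := max 0 (t - h)) ⟨le_max_left _ _, max_le hT (by linarith [htT.2])⟩ (hgt htT)
      rw [← integral_lag_indicator _ hh.le htT, ← integral_lag_indicator _ hh.le htT] at key
      rw [hqP t (Ioo_subset_Icc_self htT), hqmax (t - h) (by linarith [htT.2])]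
      refine (congrArg₂ (· + ·) rfl (congrArg₂ (· + ·) ?_ ?_)).trans_le key
      · refine intervalIntegral.integral_congr fun σ _ => ?_
        by_cases hσ : t - σ ∈ Ioo 0 T
        · simp only [indicator_of_mem hσ, fracForm_eq_integral_diffQuot]
          refine integral_congr_ae (ae_of_all _ fun x => ?_)
          simp [indicator, mem_Ioo.1 hσ, mem_Ioo.1 htS]
        · simp only [indicator_of_notMem hσ]
          refine integral_eq_zero_of_ae (ae_of_all _ fun x => ?_)
          simp only [Pi.zero_apply]
          rw [indicator_of_notMem (fun h => hσ h.2), zero_mul]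
      · refine intervalIntegral.integral_congr fun σ _ => ?_
        by_cases hσ : t - σ ∈ Ioo 0 T
        · simp only [indicator_of_mem hσ]
          rw [← integral_indicator hΩ]
          refine integral_congr_ae (ae_of_all _ fun x => ?_)
          by_cases hx : x ∈ Ω
          · simp [indicator, mem_Ioo.1 hσ, mem_Ioo.1 htS, hx]
          · simp [indicator, hx]
        · simp only [indicator_of_notMem hσ]
          refine integral_eq_zero_of_ae (ae_of_all _ fun x => ?_)
          simp only [Pi.zero_apply]
          rw [indicator_of_notMem (fun h => hσ h.2), zero_mul]
    · refine integral_nonneg fun z => ?_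
      by_cases hz : z.2 ∈ Ioo 0 S
      · have hzS : z ∈ univ ×ˢ Ioo 0 S := ⟨mem_univ _, hz⟩
        have hzT : z ∈ univ ×ˢ Ioo 0 T := ⟨mem_univ _, hsub hz⟩
        rw [Pi.zero_apply, indicator_of_mem hzT, indicator_of_mem hzS, mul_assoc]
        exact mul_nonneg (div_nonneg (fracConst_nonneg hs0 hs1) two_pos.le)
          (diffQuot_mul_posPart_nonneg (fun x => v x z.2) z.1)
      · simp only [Pi.zero_apply]
        rw [indicator_of_notMem (s := univ ×ˢ Ioo 0 S) (fun h => hz h.2), mul_zero]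
    · refine integral_nonneg_of_ae ?_
      filter_upwards [hsign'] with z hz
      by_cases hzS : z ∈ Ω ×ˢ Ioo 0 S
      · have hzT : z ∈ Ω ×ˢ Ioo 0 T := ⟨hzS.1, hsub hzS.2⟩
        rw [Pi.zero_apply, indicator_of_mem hzT, indicator_of_mem hzS]
        rcases le_or_gt (v z.1 z.2) 0 with h | h
        · rw [max_eq_right h, mul_zero]
        · exact mul_nonneg (hz hzT h) (le_max_right _ _)
      · rw [indicator_of_notMem hzS, mul_zero, Pi.zero_apply]
  have hz := lintegral_posPart_sq le_rfl hvΩ hL2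
  rw [setLIntegral_congr_fun (g := fun _ => 0) measurableSet_Ioo fun t ht => by
    simpa using hP t ht, lintegral_zero, lintegral_eq_zero_iff'
      ((hvΩ.aemeasurable.max aemeasurable_const).pow_const 2).ennreal_ofReal] at hz
  filter_upwards [hz] with z hz
  have h1 : (max (v z.1 z.2) 0) ^ 2 ≤ 0 := ENNReal.ofReal_eq_zero.1 hz
  exact max_eq_right_iff.1 (pow_eq_zero_iff two_ne_zero |>.1 (le_antisymm h1 (sq_nonneg _)))

/-! ### Affine combinations of weak solutions -/

theorem energy_lt_top_of_memLp {v : Rn n → ℝ → ℝ}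
    (h : MemLp (fun y : (Rn n × Rn n) × ℝ => diffQuot s (fun x => v x y.2) y.1) 2
      ((volume : Measure (Rn n × Rn n)).prod (volume.restrict (Ioo 0 T)))) :
    ∫⁻ t in Ioo 0 T, gagliardoSq s (fun x => v x t) < ⊤ := by
  have h' := (memLp_two_iff_lintegral_sq h.1).1 h
  rw [lintegral_prod_symm _ (h.1.aemeasurable.pow_const 2).ennreal_ofReal] at h'
  simpa only [gagliardoSq_eq_lintegral_diffQuot] using h'

theorem diffQuot_affine (U u : Rn n → ℝ) (α β c : ℝ) (z : Rn n × Rn n) :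
    diffQuot s (fun x => α * U x + β * u x + c) z =
      α * diffQuot s U z + β * diffQuot s u z := by
  simp only [diffQuot]
  ring

theorem fracForm_affine {U u φ : Rn n → ℝ} (hU : MemLp (diffQuot s U) 2 volume)
    (hu : MemLp (diffQuot s u) 2 volume) (hφ : MemLp (diffQuot s φ) 2 volume) (α β c : ℝ) :
    fracForm s (fun x => α * U x + β * u x + c) φ =
      α * fracForm s U φ + β * fracForm s u φ := by
  simp only [fracForm_eq_integral_diffQuot, diffQuot_affine]
  rw [← integral_const_mul, ← integral_const_mul, ← integral_add]
  · refine integral_congr_ae (ae_of_all _ fun z => ?_)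
    simp only
    ring
  · exact ((hU.const_mul _).integrable_mul hφ).const_mul α
  · exact ((hu.const_mul _).integrable_mul hφ).const_mul β

namespace IsWeakSolution

variable {a : Rn n → ℝ → ℝ → ℝ} {g u : Rn n → ℝ → ℝ}

theorem memLp_diffQuot_time (hu : IsWeakSolution s T Ω a g u) :
    MemLp (fun y : (Rn n × Rn n) × ℝ => diffQuot s (fun x => u x y.2) y.1) 2
      ((volume : Measure (Rn n × Rn n)).prod (volume.restrict (Ioo 0 T))) :=
  FracDiffusion.memLp_diffQuot_time hu.aestronglyMeasurable hu.energy

theorem ae_memLp_diffQuot (hu : IsWeakSolution s T Ω a g u) :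
    ∀ᵐ t, t ∈ Ioo 0 T → MemLp (diffQuot s fun x => u x t) 2 volume := by
  rw [← ae_restrict_iff' measurableSet_Ioo]
  filter_upwards [hu.memLp_diffQuot_time.integrable_sq.prod_left_ae,
    ae_restrict_mem measurableSet_Ioo] with t ht htT
  refine memLp_diffQuot (hu.memLp t (Ioo_subset_Icc_self htT)).1 ?_
  rw [gagliardoSq_eq_lintegral_diffQuot, ← ofReal_integral_eq_lintegral_ofReal ht
    (ae_of_all _ fun _ => sq_nonneg _)]
  exact ENNReal.ofReal_lt_top

theorem integrableOn_fracForm (hu : IsWeakSolution s T Ω a g u) {φ : Rn n → ℝ}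
    (hφ : IsEnergyFun s Ω φ) :
    IntegrableOn (fun τ => fracForm s (fun x => u x τ) φ) (Ioo 0 T) := by
  simp only [fracForm_eq_integral_diffQuot]
  exact integrableOn_pairing (hu.memLp_diffQuot_time.const_mul _)
    (memLp_diffQuot hφ.memLp.1 hφ.gagliardo_lt_top)

theorem nonlin_memLp_prod (hu : IsWeakSolution s T Ω a g u) :
    MemLp (fun z : Rn n × ℝ => a z.1 z.2 (u z.1 z.2)) 2
      ((volume.restrict Ω).prod (volume.restrict (Ioo 0 T))) := by
  have := hu.nonlin_memLp
  rwa [Measure.volume_eq_prod, ← Measure.prod_restrict] at this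

/-- Comparison for `v = α U + β u + c₀ + c₁ t`, with `U` a linear and `u` a semilinear solution: `v`
satisfies the equation with zeroth-order term `F = β a(x, t, u) - c₁`, because constants in space do
not contribute to the fractional form. -/
theorem affine_combination_nonpos (hs0 : 0 < s) (hs1 : s < 1) (hT : 0 < T) (hΩ : MeasurableSet Ω)
    (hΩfin : volume Ω ≠ ⊤) {h U : Rn n → ℝ → ℝ}
    (hU : IsWeakSolution s T Ω (fun _ _ _ => 0) h U) (hu : IsWeakSolution s T Ω a g u)
    (α β c₀ c₁ : ℝ)
    (hext : ∀ x, ∀ t ∈ Icc 0 T, α * h x t + β * g x t + (c₀ + c₁ * t) ≤ 0)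
    (hc₀ : c₀ ≤ 0)
    (hsign : ∀ᵐ z : Rn n × ℝ ∂(volume.restrict (Ω ×ˢ Ioo 0 T)),
      0 < α * U z.1 z.2 + β * u z.1 z.2 + (c₀ + c₁ * z.2) →
        c₁ ≤ β * a z.1 z.2 (u z.1 z.2)) :
    ∀ᵐ z : Rn n × ℝ ∂(volume.restrict (Ω ×ˢ Ioo 0 T)),
      α * U z.1 z.2 + β * u z.1 z.2 + (c₀ + c₁ * z.2) ≤ 0 := by
  have hfin : IsFiniteMeasure (volume.restrict Ω) := isFiniteMeasure_restrict.2 hΩfin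
  have hconst : ∀ c : ℝ, MemLp (fun _ : Rn n => c) 2 (volume.restrict Ω) := fun c => memLp_const c
  have h0 : (0 : ℝ) ∈ Icc 0 T := ⟨le_rfl, hT.le⟩
  refine nonpos_of_subsolution (v := fun x t => α * U x t + β * u x t + (c₀ + c₁ * t))
    (F := fun x t => β * a x t (u x t) - c₁) (w₀ := fun _ => c₀) hs0 hs1 hΩ (hconst _)
    ?_ ?_ ?_ ?_ ?_ ?_ ?_ ?_ ?_
  · refine AEMeasurable.aestronglyMeasurable ?_
    exact ((hU.aestronglyMeasurable.aemeasurable.const_mul _).add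
      (hu.aestronglyMeasurable.aemeasurable.const_mul _)).add
      (by fun_prop : Measurable fun z : Rn n × ℝ => c₀ + c₁ * z.2).aemeasurable
  · intro t ht
    exact ((((hU.memLp t ht).restrict Ω).const_mul α).add
      (((hu.memLp t ht).restrict Ω).const_mul β)).add (hconst _)
  · intro t₀ ht₀
    have hlim : Tendsto (fun t => ENNReal.ofReal |α| *
          eLpNorm (fun x => U x t - U x t₀) 2 volume + ENNReal.ofReal |β| *
          eLpNorm (fun x => u x t - u x t₀) 2 volume + ENNReal.ofReal |c₁ * t - c₁ * t₀| *
          eLpNorm (fun _ : Rn n => (1 : ℝ)) 2 (volume.restrict Ω)) (𝓝[Icc 0 T] t₀) (𝓝 0) := by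
      have l₁ := ENNReal.Tendsto.const_mul (a := ENNReal.ofReal |α|) (hU.continuous_L2 t₀ ht₀)
        (Or.inr ENNReal.ofReal_ne_top)
      have l₂ := ENNReal.Tendsto.const_mul (a := ENNReal.ofReal |β|) (hu.continuous_L2 t₀ ht₀)
        (Or.inr ENNReal.ofReal_ne_top)
      have l₃ : Tendsto (fun t => ENNReal.ofReal |c₁ * t - c₁ * t₀|) (𝓝[Icc 0 T] t₀) (𝓝 0) := by
        have hc : Continuous fun t => ENNReal.ofReal |c₁ * t - c₁ * t₀| :=
          ENNReal.continuous_ofReal.comp (by fun_prop)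
        simpa using (hc.tendsto t₀).mono_left nhdsWithin_le_nhds
      have l₄ := ENNReal.Tendsto.mul_const l₃ (Or.inr (hconst 1).2.ne)
      simpa using (l₁.add l₂).add l₄
    refine tendsto_of_tendsto_of_tendsto_of_le_of_le' tendsto_const_nhds hlim
      (Eventually.of_forall fun _ => zero_le) ?_
    filter_upwards [self_mem_nhdsWithin] with t ht
    have m₁ := ((hU.memLp t ht).sub (hU.memLp t₀ ht₀)).const_mul α
    have m₂ := ((hu.memLp t ht).sub (hu.memLp t₀ ht₀)).const_mul β
    have e : (fun x => α * U x t + β * u x t + (c₀ + c₁ * t) -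
        (α * U x t₀ + β * u x t₀ + (c₀ + c₁ * t₀))) =
        (fun x => α * (U x t - U x t₀)) + (fun x => β * (u x t - u x t₀)) +
          fun _ => (c₁ * t - c₁ * t₀) * 1 := by
      funext x
      simp only [Pi.add_apply]
      ring
    have hn : ∀ (c : ℝ) (f : Rn n → ℝ) (μ : Measure (Rn n)),
        eLpNorm (fun x => c * f x) 2 μ = ENNReal.ofReal |c| * eLpNorm f 2 μ := fun c f μ => by
      rw [← Real.enorm_eq_ofReal_abs]
      exact eLpNorm_const_smul c f 2 μ
    rw [e]
    refine (eLpNorm_add_le ((m₁.restrict Ω).add (m₂.restrict Ω)).1 (hconst _).1 (by simp)).trans ?_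
    refine add_le_add ((eLpNorm_add_le (m₁.restrict Ω).1 (m₂.restrict Ω).1 (by simp)).trans
      (add_le_add ?_ ?_)) (hn _ _ _).le
    · exact (eLpNorm_mono_measure _ Measure.restrict_le_self).trans (hn _ _ _).le
    · exact (eLpNorm_mono_measure _ Measure.restrict_le_self).trans (hn _ _ _).le
  · apply energy_lt_top_of_memLp
    simp only [diffQuot_affine]
    exact (hU.memLp_diffQuot_time.const_mul α).add (hu.memLp_diffQuot_time.const_mul β)
  · have : IsFiniteMeasure (volume.restrict (Ω ×ˢ Ioo 0 T) : Measure (Rn n × ℝ)) := by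
      rw [Measure.volume_eq_prod, ← Measure.prod_restrict]
      infer_instance
    exact (hu.nonlin_memLp.const_mul β).sub (memLp_const c₁)
  · intro t ht
    filter_upwards [hU.exterior t ht, hu.exterior t ht] with x h1 h2 hx
    rw [h1 hx, h2 hx]
    exact hext x t ht
  · filter_upwards [ae_restrict_of_ae hU.initial, ae_restrict_of_ae hu.initial] with x h1 h2
    simpa [h1, h2] using hc₀
  · intro φ hφ t ht
    have hφΩ : MemLp φ 2 (volume.restrict Ω) := hφ.memLp.restrict Ω
    have hφi : IntegrableOn φ Ω := hφΩ.integrable (by norm_num)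
    have eU := hU.equation φ hφ t ht
    have eu := hu.equation φ hφ t ht
    have hsub : uIoc 0 t ⊆ Ioc 0 T := by
      rw [uIoc_of_le ht.1]
      exact Ioc_subset_Ioc_right ht.2
    -- The endpoint `T` is a null set, outside the open interval where the slices are controlled.
    have hne : ∀ᵐ τ : ℝ, τ ≠ T := by simp [ae_iff]
    have p₁ : ∫ x in Ω, (α * U x t + β * u x t + (c₀ + c₁ * t) - c₀) * φ x =
        α * (∫ x in Ω, U x t * φ x) + β * (∫ x in Ω, u x t * φ x) + c₁ * t * ∫ x in Ω, φ x := by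
      have i₁ := (((hU.memLp t ht).restrict Ω).integrable_mul hφΩ).const_mul α
      have i₂ := (((hu.memLp t ht).restrict Ω).integrable_mul hφΩ).const_mul β
      simp only [Pi.mul_apply] at i₁ i₂
      have i₃ : Integrable (fun x => α * (U x t * φ x) + β * (u x t * φ x))
          (volume.restrict Ω) := i₁.add i₂
      rw [← integral_const_mul, ← integral_const_mul, ← integral_const_mul,
        ← integral_add i₁ i₂, ← integral_add i₃ (hφi.const_mul _)]
      refine integral_congr_ae (ae_of_all _ fun x => ?_)
      ring
    have p₂ : ∫ τ in (0 : ℝ)..t,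
        fracForm s (fun x => α * U x τ + β * u x τ + (c₀ + c₁ * τ)) φ =
        α * (∫ τ in (0 : ℝ)..t, fracForm s (fun x => U x τ) φ) +
          β * ∫ τ in (0 : ℝ)..t, fracForm s (fun x => u x τ) φ := by
      rw [← intervalIntegral.integral_const_mul, ← intervalIntegral.integral_const_mul,
        ← intervalIntegral.integral_add
          ((intervalIntegrable_of_integrableOn_Ioo (hU.integrableOn_fracForm hφ) h0 ht).const_mul _)
          ((intervalIntegrable_of_integrableOn_Ioo (hu.integrableOn_fracForm hφ) h0 ht).const_mul _)]
      refine intervalIntegral.integral_congr_ae ?_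
      filter_upwards [hU.ae_memLp_diffQuot, hu.ae_memLp_diffQuot, hne] with τ h1 h2 h3 h4
      have hτ : τ ∈ Ioo 0 T := ⟨(hsub h4).1, lt_of_le_of_ne (hsub h4).2 h3⟩
      exact fracForm_affine (h1 hτ) (h2 hτ) (memLp_diffQuot hφ.memLp.1 hφ.gagliardo_lt_top) _ _ _
    have p₃ : ∫ τ in (0 : ℝ)..t, ∫ x in Ω, (β * a x τ (u x τ) - c₁) * φ x =
        β * (∫ τ in (0 : ℝ)..t, ∫ x in Ω, a x τ (u x τ) * φ x) - c₁ * t * ∫ x in Ω, φ x := by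
      have hi : IntegrableOn (fun τ => ∫ x in Ω, a x τ (u x τ) * φ x) (Ioo 0 T) :=
        integrableOn_pairing hu.nonlin_memLp_prod hφΩ
      have hc : ∫ τ in (0 : ℝ)..t, (c₁ * ∫ x in Ω, φ x) = c₁ * t * ∫ x in Ω, φ x := by
        rw [intervalIntegral.integral_const, smul_eq_mul]
        ring
      rw [← hc, ← intervalIntegral.integral_const_mul, ← intervalIntegral.integral_sub
        ((intervalIntegrable_of_integrableOn_Ioo hi h0 ht).const_mul _) intervalIntegrable_const]
      refine intervalIntegral.integral_congr_ae ?_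
      have hae := (hu.nonlin_memLp_prod.integrable_mul
        (hφΩ.comp_fst (volume.restrict (Ioo 0 T)))).prod_left_ae
      rw [ae_restrict_iff' measurableSet_Ioo] at hae
      filter_upwards [hae, hne] with τ h1 h3 h4
      have hτ := h1 ⟨(hsub h4).1, lt_of_le_of_ne (hsub h4).2 h3⟩
      simp only [Pi.mul_apply] at hτ
      rw [← integral_const_mul, ← integral_const_mul,
        ← integral_sub (hτ.const_mul β) (hφi.const_mul c₁)]
      refine integral_congr_ae (ae_of_all _ fun x => ?_)
      ring
    simp only [zero_mul, integral_zero, intervalIntegral.integral_zero, add_zero] at eU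
    rw [p₁, p₂, p₃]
    linear_combination α * eU + β * eu
  · filter_upwards [hsign] with z hz hpos
    exact sub_nonneg.2 (hz hpos)

end IsWeakSolution

/-! ### Bounds on the nonlinearity and convergence -/

section PowerNonlin

variable {m : ℕ} {coef : Fin m → Rn n → ℝ → ℝ} {b : Fin m → ℝ} {x : Rn n} {t : ℝ}

theorem powerNonlin_eq_mul (z : ℝ) :
    powerNonlin coef b x t z = (∑ k, coef k x t * |z| ^ (b k)) * z := by
  rw [powerNonlin, Finset.sum_mul]

theorem abs_powerNonlin_le (hnn : ∀ k, 0 ≤ coef k x t) (hb : ∀ k, 0 < b k) {C : Fin m → ℝ}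
    (hC : ∀ k, coef k x t ≤ C k) {z R : ℝ} (hz : |z| ≤ R) :
    |powerNonlin coef b x t z| ≤ (∑ k, C k * R ^ (b k)) * R := by
  rw [powerNonlin_eq_mul, abs_mul]
  have h0 : ∀ k, 0 ≤ coef k x t * |z| ^ b k := fun k => mul_nonneg (hnn k) (by positivity)
  have hle : ∀ k, coef k x t * |z| ^ b k ≤ C k * R ^ b k := fun k =>
    mul_le_mul (hC k) (Real.rpow_le_rpow (abs_nonneg z) hz (hb k).le) (by positivity)
      ((hnn k).trans (hC k))
  rw [abs_of_nonneg (Finset.sum_nonneg fun k _ => h0 k)]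
  exact mul_le_mul (Finset.sum_le_sum fun k _ => hle k) hz (abs_nonneg z)
    (Finset.sum_nonneg fun k _ => (h0 k).trans (hle k))

theorem exists_coef_bound (hΩb : Bornology.IsBounded Ω)
    (hcont : ∀ k, ContinuousOn (fun z : Rn n × ℝ => coef k z.1 z.2) (closure Ω ×ˢ Icc 0 T)) :
    ∃ C : Fin m → ℝ, (∀ k, 0 ≤ C k) ∧ ∀ k, ∀ x ∈ closure Ω, ∀ t ∈ Icc 0 T, coef k x t ≤ C k := by
  choose C hC using fun k =>
    (hΩb.isCompact_closure.prod isCompact_Icc).exists_bound_of_continuousOn (hcont k)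
  exact ⟨fun k => |C k|, fun k => abs_nonneg _, fun k x hx t ht =>
    (le_abs_self _).trans ((hC k (x, t) ⟨hx, ht⟩).trans (le_abs_self _))⟩

end PowerNonlin

end FracDiffusion

end

theorem proposition4p1 {n m : ℕ} (hn : 2 ≤ n) (s T : ℝ) (hs0 : 0 < s) (hs1 : s < 1) (hT : 0 < T)
    (Ω : Set (FracDiffusion.Rn n)) (hΩo : IsOpen Ω) (hΩb : Bornology.IsBounded Ω)
    (coef : Fin m → FracDiffusion.Rn n → ℝ → ℝ)
    (hcoef_cont : ∀ k, ContinuousOn (fun z : FracDiffusion.Rn n × ℝ => coef k z.1 z.2)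
      (closure Ω ×ˢ Icc 0 T))
    (hcoef_nonneg : ∀ k, ∀ x ∈ closure Ω, ∀ t ∈ Icc 0 T, 0 ≤ coef k x t)
    (b : Fin m → ℝ) (hb_pos : ∀ k, 0 < b k) (hb_mono : StrictMono b)
    (g : FracDiffusion.Rn n → ℝ → ℝ)
    (hg_smooth : ContDiff ℝ ∞ (fun z : FracDiffusion.Rn n × ℝ => g z.1 z.2))
    (hg_compact : HasCompactSupport (fun z : FracDiffusion.Rn n × ℝ => g z.1 z.2))
    (hg_supp : tsupport (fun z : FracDiffusion.Rn n × ℝ => g z.1 z.2) ⊆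
      (closure Ω)ᶜ ×ˢ Ioo 0 T)
    (ug : FracDiffusion.Rn n → ℝ → ℝ)
    (hug : FracDiffusion.IsWeakSolution s T Ω (fun _ _ _ => 0) g ug) :
    ∀ ε : ℝ, 0 < ε → ∃ lam₀ : ℝ, 0 < lam₀ ∧ ∀ lam : ℝ, 0 < lam → lam < lam₀ →
      ∀ u : FracDiffusion.Rn n → ℝ → ℝ,
        FracDiffusion.IsWeakSolution s T Ω (FracDiffusion.powerNonlin coef b)
          (fun x t => lam * g x t) u →
        eLpNorm (fun z : FracDiffusion.Rn n × ℝ => ug z.1 z.2 - u z.1 z.2 / lam) ⊤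
          (volume.restrict (Ω ×ˢ Ioo 0 T)) ≤ ENNReal.ofReal ε := by
  intro ε hε
  obtain ⟨M, hM⟩ := hg_compact.exists_bound_of_continuous hg_smooth.continuous
  have hgM : ∀ x t, |g x t| ≤ M := fun x t => hM (x, t)
  have hM0 : 0 ≤ M := (abs_nonneg _).trans (hgM 0 0)
  obtain ⟨C, hC0, hC⟩ := FracDiffusion.exists_coef_bound hΩb hcoef_cont
  -- `K lam` bounds `|a(x, t, z)| / lam` for `|z| ≤ lam * M`; it vanishes at `0` since each `b k > 0`.
  set K : ℝ → ℝ := fun lam => (∑ k, C k * (lam * M) ^ b k) * M with hK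
  have hKc : Continuous K := by
    refine (continuous_finsetSum _ fun k _ => continuous_const.mul ?_).mul continuous_const
    exact (Real.continuous_rpow_const (hb_pos k).le).comp (by fun_prop)
  have hK0 : K 0 = 0 := by
    simp only [hK, zero_mul, Real.zero_rpow (hb_pos _).ne', mul_zero, Finset.sum_const_zero]
  have hlim : ∀ᶠ lam in 𝓝[>] (0 : ℝ), K lam * T < ε := by
    have h : Tendsto (fun lam => K lam * T) (𝓝 0) (𝓝 0) := by
      simpa [hK0] using (hKc.mul_const T).tendsto 0
    exact (h.mono_left nhdsWithin_le_nhds).eventually (gt_mem_nhds hε)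
  obtain ⟨lam₀, hlam₀, hsmall⟩ := mem_nhdsGT_iff_exists_Ioo_subset.1 hlim
  refine ⟨lam₀, hlam₀, fun lam hlam hlt u hu => ?_⟩
  have hKT : K lam * T < ε := hsmall ⟨hlam, hlt⟩
  have hΩm := hΩo.measurableSet
  have hmem : ∀ᵐ z : FracDiffusion.Rn n × ℝ ∂(volume.restrict (Ω ×ˢ Ioo 0 T)),
      z ∈ Ω ×ˢ Ioo 0 T :=
    ae_restrict_mem (hΩm.prod measurableSet_Ioo)
  have hnn : ∀ z ∈ Ω ×ˢ Ioo 0 T, ∀ k, 0 ≤ coef k z.1 z.2 := fun z hz k =>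
    hcoef_nonneg k _ (subset_closure hz.1) _ (Ioo_subset_Icc_self hz.2)
  have hsup : ∀ z ∈ Ω ×ˢ Ioo 0 T, ∀ k, coef k z.1 z.2 ≤ C k := fun z hz k =>
    hC k _ (subset_closure hz.1) _ (Ioo_subset_Icc_self hz.2)
  have hcmp := hug.affine_combination_nonpos hs0 hs1 hT hΩm hΩb.measure_lt_top.ne hu
  have habs : ∀ e : ℝ, |e| = 1 → ∀ y, e * y ≤ |y| := fun e he y => by
    simpa [abs_mul, he] using le_abs_self (e * y)
  -- Comparison of `±u` with the constant `lam * M`, a supersolution by the sign of the nonlinearity.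
  have hbound : ∀ e : ℝ, |e| = 1 →
      ∀ᵐ z : FracDiffusion.Rn n × ℝ ∂(volume.restrict (Ω ×ˢ Ioo 0 T)),
      e * u z.1 z.2 ≤ lam * M := by
    intro e he
    have := hcmp 0 e (-(lam * M)) 0 ?_ ?_ ?_
    · filter_upwards [this] with z hz
      linarith
    · intro x t _
      have h1 := mul_le_mul_of_nonneg_left ((habs e he (g x t)).trans (hgM x t)) hlam.le
      linarith
    · have := mul_nonneg hlam.le hM0
      linarith
    · filter_upwards [hmem] with z hz hpos
      have h1 : 0 ≤ e * u z.1 z.2 := by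
        have := mul_nonneg hlam.le hM0
        linarith
      rw [FracDiffusion.powerNonlin_eq_mul, mul_left_comm]
      exact mul_nonneg (Finset.sum_nonneg fun k _ => mul_nonneg (hnn z hz k) (by positivity)) h1
  have hulam : ∀ᵐ z : FracDiffusion.Rn n × ℝ ∂(volume.restrict (Ω ×ˢ Ioo 0 T)),
      |u z.1 z.2| ≤ lam * M := by
    filter_upwards [hbound 1 (by simp), hbound (-1) (by simp)] with z h1 h2
    exact abs_le.2 ⟨by linarith, by linarith⟩
  have hnl : ∀ᵐ z : FracDiffusion.Rn n × ℝ ∂(volume.restrict (Ω ×ˢ Ioo 0 T)),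
      |FracDiffusion.powerNonlin coef b z.1 z.2 (u z.1 z.2)| ≤ K lam * lam := by
    filter_upwards [hulam, hmem] with z h1 hz
    refine (FracDiffusion.abs_powerNonlin_le (hnn z hz) hb_pos (hsup z hz) h1).trans_eq ?_
    simp only [hK]
    ring
  have hK1 : 0 ≤ K lam := by
    refine mul_nonneg (Finset.sum_nonneg fun k _ => mul_nonneg (hC0 k) ?_) hM0
    exact Real.rpow_nonneg (mul_nonneg hlam.le hM0) _
  -- The difference solves the linear equation with zero exterior data and a source of size at most
  -- `K lam`, so it stays below the barrier `K lam * t`.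
  have hdiff : ∀ e : ℝ, |e| = 1 →
      ∀ᵐ z : FracDiffusion.Rn n × ℝ ∂(volume.restrict (Ω ×ˢ Ioo 0 T)),
      e * (ug z.1 z.2 - u z.1 z.2 / lam) ≤ K lam * z.2 := by
    intro e he
    have := hcmp e (-(e / lam)) 0 (-(K lam)) ?_ le_rfl ?_
    · filter_upwards [this] with z hz
      have : e * (ug z.1 z.2 - u z.1 z.2 / lam) = e * ug z.1 z.2 + -(e / lam) * u z.1 z.2 := by
        ring
      linarith
    · intro x t ht
      have h1 : e / lam * (lam * g x t) = e * g x t := by field_simp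
      have := mul_nonneg hK1 ht.1
      linarith
    · filter_upwards [hnl] with z hz _
      have h1 := (habs e he _).trans hz
      have h2 : e / lam * FracDiffusion.powerNonlin coef b z.1 z.2 (u z.1 z.2) ≤ K lam := by
        rw [div_mul_eq_mul_div, div_le_iff₀ hlam]
        exact h1
      linarith
  rw [eLpNorm_exponent_top]
  refine eLpNormEssSup_le_of_ae_bound ?_
  filter_upwards [hdiff 1 (by simp), hdiff (-1) (by simp), hmem] with z h1 h2 hz
  have h3 := mul_le_mul_of_nonneg_left hz.2.2.le hK1
  rw [Real.norm_eq_abs, abs_le]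
  constructor <;> linarith
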